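/- Let $F$ be a perfect field of prime characteristic $p\neq 2$ and let $L$ be a finite-dimensional restricted Lie algebra over $F$, with $p$-mapping $x\mapsto x^{[p]}$, that is nilpotent as a Lie algebra. A subalgebra (or ideal) $H$ of $L$ is called restricted if $x^{[p]}\in H$ for all $x\in H$; it is then itself a restricted Lie algebra. A restricted subalgebra $S$ of a restricted Lie algebra $M$ is called a restricted quasi-ideal of $M$ if $[S,H]\subseteq S+H$ for every restricted subalgebra $H$ of $M$. A restricted Lie algebra is called a torus if it is abelian and each of its elements $x$ is semisimple, that is, $x$ lies in the restricted subalgebra generated by $x^{[p]}$; it is called $p$-nilpotent if there is an $n>0$ such that $x^{[p]^n}=0$ for all its elements $x$. Then every restricted subalgebra of $L$ is a restricted quasi-ideal of $L$ if and only if there are restricted ideals $S$ and $P$ of $L$ such that $L=S\oplus P$, $S$ is a torus, $P$ is $p$-nilpotent, and every restricted subalgebra of $P$ is a restricted quasi-ideal of $P$. -/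

import Mathlib

/-- `jacobsonCoeff x y n k` is the coefficient of `X ^ k` in `ad (X ⊗ x + 1 ⊗ y) ^ n (1 ⊗ x)`,
computed in the Lie algebra of polynomials with coefficients in `L`
(see `ad_pow_eq_sum_jacobsonCoeff`). -/
def jacobsonCoeff {L : Type*} [LieRing L] (x y : L) : ℕ → ℕ → L
  | 0, 0 => x
  | 0, _ + 1 => 0
  | n + 1, 0 => ⁅y, jacobsonCoeff x y n 0⁆
  | n + 1, k + 1 => ⁅x, jacobsonCoeff x y n k⁆ + ⁅y, jacobsonCoeff x y n (k + 1)⁆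

theorem jacobsonCoeff_eq_zero {L : Type*} [LieRing L] (x y : L) (n : ℕ) :
    ∀ k : ℕ, n < k → jacobsonCoeff x y n k = 0 := by
  induction n with
  | zero =>
    intro k hk
    obtain ⟨k, rfl⟩ := Nat.exists_eq_add_of_lt hk
    simp [jacobsonCoeff]
  | succ n ih =>
    intro k hk
    cases k with
    | zero => omega
    | succ k =>
      rw [jacobsonCoeff, ih k (by omega), ih (k + 1) (by omega)]
      simp

open scoped TensorProduct in
/-- The defining property of `jacobsonCoeff`. -/
theorem ad_pow_eq_sum_jacobsonCoeff {F L : Type*} [Field F] [LieRing L] [LieAlgebra F L]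
    (x y : L) (n : ℕ) :
    ((LieAlgebra.ad (Polynomial F) (Polynomial F ⊗[F] L)
        ((Polynomial.X : Polynomial F) ⊗ₜ[F] x + (1 : Polynomial F) ⊗ₜ[F] y)) ^ n)
        ((1 : Polynomial F) ⊗ₜ[F] x) =
      ∑ k ∈ Finset.range (n + 1),
        ((Polynomial.X : Polynomial F) ^ k) ⊗ₜ[F] jacobsonCoeff x y n k := by
  induction n with
  | zero => simp [jacobsonCoeff]
  | succ n ih =>
    rw [pow_succ', Module.End.mul_apply, ih, LieAlgebra.ad_apply, lie_sum]
    simp only [add_lie, LieAlgebra.ExtendScalars.bracket_tmul, one_mul, Finset.sum_add_distrib]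
    rw [Finset.sum_range_succ' _ (n + 1)]
    simp only [jacobsonCoeff, TensorProduct.tmul_add, Finset.sum_add_distrib]
    rw [add_assoc]
    congr 1
    · exact Finset.sum_congr rfl fun k _ => by rw [pow_succ']
    · rw [Finset.sum_range_succ' _ n, Finset.sum_range_succ _ n,
        jacobsonCoeff_eq_zero x y n (n + 1) (by omega)]
      simp

/-- The term `s_i(x, y)` of Jacobson's formula: `i s_i(x, y)` is the coefficient of `X ^ (i - 1)`
in `ad (X ⊗ x + 1 ⊗ y) ^ (p - 1) (1 ⊗ x)`. It is used for `1 ≤ i ≤ p - 1` only. -/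
def jacobsonTerm (F : Type*) {L : Type*} [Field F] [LieRing L] [LieAlgebra F L]
    (p : ℕ) (x y : L) (i : ℕ) : L :=
  (i : F)⁻¹ • jacobsonCoeff x y (p - 1) (i - 1)

/-- A `p`-mapping on a Lie algebra `L` over a field `F` (of characteristic `p`); a restricted Lie
algebra is a Lie algebra together with a `p`-mapping. -/
structure PMapping (p : ℕ) (F L : Type*) [Field F] [LieRing L] [LieAlgebra F L] where
  /-- The map `x ↦ x^{[p]}`. -/
  toFun : L → L
  ad_map : ∀ x y : L, ⁅toFun x, y⁆ = ((LieAlgebra.ad F L x) ^ p) y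
  map_smul : ∀ (c : F) (x : L), toFun (c • x) = c ^ p • toFun x
  map_add : ∀ x y : L,
    toFun (x + y) = toFun x + toFun y + ∑ i ∈ Finset.Icc 1 (p - 1), jacobsonTerm F p x y i

namespace PMapping

variable {p : ℕ} {F L : Type*} [Field F] [LieRing L] [LieAlgebra F L]

/-- A subalgebra is restricted if it is closed under the `p`-mapping. -/
def IsRestricted (φ : PMapping p F L) (H : LieSubalgebra F L) : Prop :=
  ∀ x ∈ H, φ.toFun x ∈ H

theorem coe_jacobsonCoeff (H : LieSubalgebra F L) (x y : H) (n : ℕ) :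
    ∀ k : ℕ, ((jacobsonCoeff x y n k : H) : L) = jacobsonCoeff (x : L) (y : L) n k := by
  induction n with
  | zero => intro k; cases k <;> simp [jacobsonCoeff]
  | succ n ih => intro k; cases k <;> simp [jacobsonCoeff, ih]

theorem coe_ad_pow (H : LieSubalgebra F L) (x y : H) (n : ℕ) :
    ((((LieAlgebra.ad F H x) ^ n) y : H) : L) = ((LieAlgebra.ad F L (x : L)) ^ n) (y : L) := by
  induction n with
  | zero => simp
  | succ n ih => simp [pow_succ', Module.End.mul_apply, ih]

/-- A restricted subalgebra is a restricted Lie algebra under the restriction of the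
`p`-mapping. -/
def restrict (φ : PMapping p F L) (H : LieSubalgebra F L) (hH : φ.IsRestricted H) :
    PMapping p F H where
  toFun x := ⟨φ.toFun x, hH x x.2⟩
  ad_map x y := Subtype.ext (by
    rw [coe_ad_pow, LieSubalgebra.coe_bracket]
    exact φ.ad_map x y)
  map_smul c x := Subtype.ext (φ.map_smul c x)
  map_add x y := Subtype.ext (by
    have key : ((∑ i ∈ Finset.Icc 1 (p - 1), jacobsonTerm F p x y i : H) : L) =
        ∑ i ∈ Finset.Icc 1 (p - 1), jacobsonTerm F p (x : L) (y : L) i := by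
      rw [AddSubmonoidClass.coe_finsetSum]
      exact Finset.sum_congr rfl fun i _ =>
        congrArg (fun z : L => (i : F)⁻¹ • z) (coe_jacobsonCoeff H x y (p - 1) (i - 1))
    have h := φ.map_add x y
    rw [← key] at h
    exact h)

/-- The restricted subalgebra generated by a set. -/
def closure (φ : PMapping p F L) (s : Set L) : LieSubalgebra F L :=
  sInf {H : LieSubalgebra F L | φ.IsRestricted H ∧ s ⊆ H}

/-- `x` is semisimple if it lies in the restricted subalgebra generated by `x^{[p]}`. -/
def IsSemisimpleElt (φ : PMapping p F L) (x : L) : Prop :=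
  x ∈ φ.closure {φ.toFun x}

/-- The restricted Lie algebra `L` is a torus: it is abelian and consists of semisimple
elements. -/
def IsTorus (φ : PMapping p F L) : Prop :=
  IsLieAbelian L ∧ ∀ x : L, φ.IsSemisimpleElt x

/-- The restricted Lie algebra `L` is `p`-nilpotent: some iterate of the `p`-mapping is zero. -/
def IsPNilpotent (φ : PMapping p F L) : Prop :=
  ∃ n : ℕ, 0 < n ∧ ∀ x : L, φ.toFun^[n] x = 0

/-- `S` is a restricted quasi-ideal of `L`: it is a restricted subalgebra and `[S, H] ⊆ S + H` for
every restricted subalgebra `H` of `L`. -/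
def IsRestrictedQuasiIdeal (φ : PMapping p F L) (S : LieSubalgebra F L) : Prop :=
  φ.IsRestricted S ∧ ∀ H : LieSubalgebra F L, φ.IsRestricted H →
    ∀ s ∈ S, ∀ h ∈ H, ⁅s, h⁆ ∈ S.toSubmodule ⊔ H.toSubmodule

/-- Every restricted subalgebra of `L` is a restricted quasi-ideal of `L`. -/
def AllRestrictedQuasiIdeals (φ : PMapping p F L) : Prop :=
  ∀ S : LieSubalgebra F L, φ.IsRestricted S → φ.IsRestrictedQuasiIdeal S

end PMapping

/-! On commuting elements the `p`-mapping is additive and Frobenius-semilinear, so over a perfect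
field each `x` splits as semisimple plus nil inside the span of its iterates
(`exists_semisimple_add_nil`). In a nilpotent `L` semisimple elements are central
(`lie_eq_zero_of_mem_powSpan`); their span is a torus without nonzero nil elements
(`IsNil.eq_zero`).

If all restricted subalgebras are quasi-ideals, those generated by two nil elements add up to a
restricted subalgebra. A semisimple element in it is central, hence a sum of two commuting nil
elements, hence zero (`AllRestrictedQuasiIdeals.isNil_of_mem_sup`). So the nil elements form an
ideal complementary to the torus.

Conversely, `S` is central and the `P`-component of an element of a restricted subalgebra stays in
it (`mem_of_add_mem`), so brackets reduce to brackets in `P`. -/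

namespace PMapping

variable {p : ℕ} {F L : Type*} [Field F] [LieRing L] [LieAlgebra F L]

/-! ### Jacobson's formula and restricted subalgebras -/

theorem jacobsonCoeff_mem (H : LieSubalgebra F L) {x y : L} (hx : x ∈ H) (hy : y ∈ H) (n : ℕ) :
    ∀ k : ℕ, jacobsonCoeff x y n k ∈ H := fun k => by
  rw [← coe_jacobsonCoeff H ⟨x, hx⟩ ⟨y, hy⟩ n k]
  exact Subtype.mem _

theorem jacobsonCoeff_of_lie_eq_zero {x y : L} (h : ⁅x, y⁆ = 0) (n : ℕ) :
    ∀ k : ℕ, jacobsonCoeff x y (n + 1) k = 0 := by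
  have h' : ⁅y, x⁆ = 0 := by rw [← lie_skew, h, neg_zero]
  induction n with
  | zero =>
    rintro (_ | _ | k) <;> simp [jacobsonCoeff, h']
  | succ n ih =>
    rintro (_ | k)
    · rw [jacobsonCoeff, ih, lie_zero]
    · rw [jacobsonCoeff, ih, ih, lie_zero, lie_zero, add_zero]

/-- Jacobson's correction terms are combinations of iterated brackets of `x` and `y`. -/
theorem toFun_add_mem (φ : PMapping p F L) (H : LieSubalgebra F L) {x y : L}
    (hx : x ∈ H) (hy : y ∈ H) (hφx : φ.toFun x ∈ H) (hφy : φ.toFun y ∈ H) :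
    φ.toFun (x + y) ∈ H := by
  rw [φ.map_add]
  exact add_mem (add_mem hφx hφy)
    (sum_mem fun i _ => H.smul_mem _ (jacobsonCoeff_mem H hx hy _ _))

theorem IsRestricted.iterate_mem {φ : PMapping p F L} {H : LieSubalgebra F L}
    (hH : φ.IsRestricted H) {x : L} (hx : x ∈ H) (n : ℕ) : φ.toFun^[n] x ∈ H := by
  induction n with
  | zero => exact hx
  | succ n ih => rw [Function.iterate_succ_apply']; exact hH _ ih

theorem coe_restrict_iterate (φ : PMapping p F L) (H : LieSubalgebra F L) (hH : φ.IsRestricted H)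
    (x : H) (n : ℕ) : (((φ.restrict H hH).toFun^[n] x : H) : L) = φ.toFun^[n] (x : L) := by
  induction n with
  | zero => rfl
  | succ n ih =>
    rw [Function.iterate_succ_apply', Function.iterate_succ_apply', ← ih]
    rfl

/-! ### Iterates of the `p`-mapping and their spans -/

/-- An element is nil if some iterate of the `p`-mapping kills it. -/
def IsNil (φ : PMapping p F L) (x : L) : Prop := ∃ n, φ.toFun^[n] x = 0

/-- The span of the iterates `φ^j x` for `i ≤ j`. -/
def powSpan (φ : PMapping p F L) (x : L) (i : ℕ) : Submodule F L :=
  Submodule.span F {y | ∃ j, i ≤ j ∧ φ.toFun^[j] x = y}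

theorem iterate_mem_powSpan (φ : PMapping p F L) (x : L) {i j : ℕ} (h : i ≤ j) :
    φ.toFun^[j] x ∈ φ.powSpan x i := Submodule.subset_span ⟨j, h, rfl⟩

theorem powSpan_le (φ : PMapping p F L) {x : L} {i : ℕ} {M : Submodule F L}
    (h : ∀ j, i ≤ j → φ.toFun^[j] x ∈ M) : φ.powSpan x i ≤ M :=
  Submodule.span_le.2 (by rintro _ ⟨j, hj, rfl⟩; exact h j hj)

theorem powSpan_antitone (φ : PMapping p F L) (x : L) : Antitone (φ.powSpan x) :=
  fun _ _ h => φ.powSpan_le fun _ hj => φ.iterate_mem_powSpan x (h.trans hj)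

theorem iterate_smul (φ : PMapping p F L) (c : F) (x : L) (n : ℕ) :
    φ.toFun^[n] (c • x) = c ^ p ^ n • φ.toFun^[n] x := by
  induction n with
  | zero => simp
  | succ n ih => rw [Function.iterate_succ_apply', ih, φ.map_smul, ← pow_mul, ← pow_succ,
      Function.iterate_succ_apply']

theorem ad_iterate (φ : PMapping p F L) (x y : L) (n : ℕ) :
    ⁅φ.toFun^[n] x, y⁆ = ((LieAlgebra.ad F L x) ^ p ^ n) y := by
  have : LieAlgebra.ad F L (φ.toFun^[n] x) = (LieAlgebra.ad F L x) ^ p ^ n := by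
    induction n with
    | zero => simp
    | succ n ih =>
      rw [pow_succ, pow_mul, ← ih, Function.iterate_succ_apply']
      ext y
      exact φ.ad_map _ y
  rw [← this, LieAlgebra.ad_apply]

theorem powSpan_le_zero (φ : PMapping p F L) (x : L) (i : ℕ) : φ.powSpan x i ≤ φ.powSpan x 0 :=
  φ.powSpan_antitone x (Nat.zero_le i)

theorem powSpan_le_of_isRestricted (φ : PMapping p F L) {H : LieSubalgebra F L} (hH : φ.IsRestricted H) {x : L}
    (hx : x ∈ H) : φ.powSpan x 0 ≤ H.toSubmodule :=
  φ.powSpan_le fun j _ => hH.iterate_mem hx j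

theorem mem_closure {φ : PMapping p F L} (s : Set L) {x : L} :
    x ∈ φ.closure s ↔ ∀ H : LieSubalgebra F L, φ.IsRestricted H ∧ s ⊆ H → x ∈ H := by
  rw [closure, ← SetLike.mem_coe, LieSubalgebra.coe_sInf]
  simp only [Set.mem_iInter, Set.mem_ofPred_eq, SetLike.mem_coe]

theorem IsNil.smul {φ : PMapping p F L} {x : L} (hx : φ.IsNil x) (c : F) : φ.IsNil (c • x) := by
  obtain ⟨m, hm⟩ := hx
  exact ⟨m, by rw [φ.iterate_smul, hm, smul_zero]⟩

section Prime

variable [Fact p.Prime] (φ : PMapping p F L)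

theorem toFun_zero : φ.toFun 0 = 0 := by
  have := φ.map_smul 0 0
  rwa [zero_smul, zero_pow (Fact.out : p.Prime).ne_zero, zero_smul] at this

theorem iterate_zero_eq (n : ℕ) : φ.toFun^[n] 0 = 0 :=
  Function.iterate_fixed φ.toFun_zero n

theorem toFun_add_of_lie {x y : L} (h : ⁅x, y⁆ = 0) :
    φ.toFun (x + y) = φ.toFun x + φ.toFun y := by
  rw [φ.map_add, Finset.sum_eq_zero, add_zero]
  intro i _
  obtain ⟨m, hm⟩ := Nat.exists_eq_add_of_le' (Nat.sub_pos_of_lt (Fact.out : p.Prime).one_lt)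
  rw [jacobsonTerm, hm, jacobsonCoeff_of_lie_eq_zero h, smul_zero]

theorem lie_toFun_left {x y : L} (h : ⁅x, y⁆ = 0) : ⁅φ.toFun x, y⁆ = 0 := by
  obtain ⟨m, hm⟩ := Nat.exists_eq_succ_of_ne_zero (Fact.out : p.Prime).ne_zero
  rw [φ.ad_map, hm, pow_succ, Module.End.mul_apply, LieAlgebra.ad_apply, h, map_zero]

theorem lie_iterate_left {x y : L} (h : ⁅x, y⁆ = 0) (n : ℕ) : ⁅φ.toFun^[n] x, y⁆ = 0 := by
  induction n with
  | zero => exact h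
  | succ n ih => rw [Function.iterate_succ_apply']; exact φ.lie_toFun_left ih

theorem lie_iterate_right {x y : L} (h : ⁅x, y⁆ = 0) (n : ℕ) : ⁅x, φ.toFun^[n] y⁆ = 0 := by
  rw [← lie_skew, φ.lie_iterate_left, neg_zero]
  rw [← lie_skew, h, neg_zero]

theorem iterate_add_of_lie {x y : L} (h : ⁅x, y⁆ = 0) (n : ℕ) :
    φ.toFun^[n] (x + y) = φ.toFun^[n] x + φ.toFun^[n] y := by
  induction n with
  | zero => rfl
  | succ n ih =>
    rw [Function.iterate_succ_apply', ih, φ.toFun_add_of_lie, Function.iterate_succ_apply',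
      Function.iterate_succ_apply']
    exact φ.lie_iterate_left (φ.lie_iterate_right h n) n

theorem IsNil.iterate_eq_zero {φ : PMapping p F L} {x : L} {m n : ℕ} (h : φ.toFun^[m] x = 0)
    (hmn : m ≤ n) : φ.toFun^[n] x = 0 := by
  obtain ⟨k, rfl⟩ := Nat.exists_eq_add_of_le' hmn
  rw [Function.iterate_add_apply, h, φ.iterate_zero_eq]

variable {φ} in
theorem IsNil.add {x y : L} (hx : φ.IsNil x) (hy : φ.IsNil y) (h : ⁅x, y⁆ = 0) :
    φ.IsNil (x + y) := by
  obtain ⟨m, hm⟩ := hx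
  obtain ⟨n, hn⟩ := hy
  exact ⟨max m n, by rw [φ.iterate_add_of_lie h, IsNil.iterate_eq_zero hm (le_max_left _ _),
    IsNil.iterate_eq_zero hn (le_max_right _ _), add_zero]⟩

theorem lie_powSpan {x a b : L} (ha : a ∈ φ.powSpan x 0) (hb : b ∈ φ.powSpan x 0) :
    ⁅a, b⁆ = 0 := by
  induction ha, hb using Submodule.span_induction₂ with
  | mem_mem a b ha hb =>
    obtain ⟨i, -, rfl⟩ := ha
    obtain ⟨j, -, rfl⟩ := hb
    exact φ.lie_iterate_left (φ.lie_iterate_right (lie_self x) j) i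
  | zero_left => exact zero_lie _
  | zero_right => exact lie_zero _
  | add_left a b c _ _ _ h₁ h₂ => rw [add_lie, h₁, h₂, add_zero]
  | add_right a b c _ _ _ h₁ h₂ => rw [lie_add, h₁, h₂, add_zero]
  | smul_left r a b _ _ h => rw [smul_lie, h, smul_zero]
  | smul_right r a b _ _ h => rw [lie_smul, h, smul_zero]

theorem toFun_mem_powSpan {x w : L} {i : ℕ} (hw : w ∈ φ.powSpan x i) :
    φ.toFun w ∈ φ.powSpan x (i + 1) := by
  induction hw using Submodule.span_induction with
  | mem w hw =>
    obtain ⟨j, hj, rfl⟩ := hw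
    rw [← Function.iterate_succ_apply' φ.toFun]
    exact φ.iterate_mem_powSpan x (by omega)
  | zero => rw [φ.toFun_zero]; exact zero_mem _
  | add a b ha hb h₁ h₂ =>
    rw [φ.toFun_add_of_lie
      (φ.lie_powSpan (φ.powSpan_le_zero x i ha) (φ.powSpan_le_zero x i hb))]
    exact add_mem h₁ h₂
  | smul c a _ h => rw [φ.map_smul]; exact Submodule.smul_mem _ _ h

theorem iterate_mem_powSpan_add {x w : L} {i : ℕ} (hw : w ∈ φ.powSpan x i) (n : ℕ) :
    φ.toFun^[n] w ∈ φ.powSpan x (i + n) := by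
  induction n with
  | zero => exact hw
  | succ n ih => rw [Function.iterate_succ_apply']; exact φ.toFun_mem_powSpan ih

/-- The restricted subalgebra spanned by the iterates of `x`. -/
def powSubalgebra (x : L) : LieSubalgebra F L where
  __ := φ.powSpan x 0
  lie_mem' ha hb := by
    rw [φ.lie_powSpan ha hb]
    exact zero_mem (φ.powSpan x 0)

theorem self_mem_powSubalgebra (x : L) : x ∈ φ.powSubalgebra x :=
  φ.iterate_mem_powSpan x (le_refl 0)

theorem isRestricted_powSubalgebra (x : L) : φ.IsRestricted (φ.powSubalgebra x) :=
  fun _ hy => φ.powSpan_le_zero x 1 (φ.toFun_mem_powSpan hy)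

theorem IsNil.of_mem_powSpan {φ : PMapping p F L} {x y : L} (hx : φ.IsNil x)
    (hy : y ∈ φ.powSpan x 0) : φ.IsNil y := by
  obtain ⟨n, hn⟩ := hx
  refine ⟨n, ?_⟩
  have h₁ := φ.iterate_mem_powSpan_add hy n
  have h₂ : φ.powSpan x (0 + n) ≤ ⊥ := φ.powSpan_le fun j hj =>
    (Submodule.mem_bot F).2 (IsNil.iterate_eq_zero hn (by omega))
  exact (Submodule.mem_bot F).1 (h₂ h₁)

/-- Applying the `p`-mapping to the relation shifts it, so the descending chain is constant from `i`
on. -/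
theorem powSpan_le_succ {x : L} {i : ℕ} (h : φ.toFun^[i] x ∈ φ.powSpan x (i + 1)) :
    ∀ j, i ≤ j → φ.powSpan x i ≤ φ.powSpan x j := by
  have key : ∀ j, i ≤ j → φ.powSpan x j ≤ φ.powSpan x (j + 1) := by
    intro j hj
    refine φ.powSpan_le fun k hk => ?_
    rcases hk.eq_or_lt with rfl | hk
    · obtain ⟨m, rfl⟩ := Nat.exists_eq_add_of_le hj
      have := φ.iterate_mem_powSpan_add h m
      rwa [← Function.iterate_add_apply, add_comm m i, add_right_comm] at this
    · exact φ.iterate_mem_powSpan x hk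
  intro j hj
  induction j, hj using Nat.le_induction with
  | base => exact le_rfl
  | succ j hj ih => exact ih.trans (key j hj)

/-- Until an iterate vanishes, each step of the chain lowers the dimension. The uniform exponent is
what `p`-nilpotency of the nil ideal needs. -/
theorem IsNil.iterate_finrank [FiniteDimensional F L] {φ : PMapping p F L} {x : L}
    (hx : φ.IsNil x) : φ.toFun^[Module.finrank F L] x = 0 := by
  obtain ⟨n, hn⟩ := hx
  have key : ∀ i, φ.toFun^[i] x = 0 ∨
      Module.finrank F (φ.powSpan x i) + i ≤ Module.finrank F L := by
    intro i
    induction i with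
    | zero => exact Or.inr (Submodule.finrank_le _)
    | succ i ih =>
      rcases ih with h | h
      · exact Or.inl (IsNil.iterate_eq_zero h (Nat.le_succ i))
      by_cases hi : φ.toFun^[i] x ∈ φ.powSpan x (i + 1)
      · have h₁ := φ.powSpan_le_succ hi (i + n) (by omega) (φ.iterate_mem_powSpan x le_rfl)
        have h₂ : φ.powSpan x (i + n) ≤ ⊥ := φ.powSpan_le fun j hj =>
          (Submodule.mem_bot F).2 (IsNil.iterate_eq_zero hn (by omega))
        exact Or.inl (IsNil.iterate_eq_zero ((Submodule.mem_bot F).1 (h₂ h₁)) (Nat.le_succ i))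
      · right
        have hlt : φ.powSpan x (i + 1) < φ.powSpan x i :=
          lt_of_le_not_ge (φ.powSpan_antitone x (Nat.le_succ i))
            fun hle => hi (hle (φ.iterate_mem_powSpan x le_rfl))
        have := Submodule.finrank_lt_finrank_of_lt hlt
        omega
  rcases key (Module.finrank F L) with h | h
  · exact h
  · have h0 : φ.powSpan x (Module.finrank F L) = ⊥ := Submodule.finrank_eq_zero.1 (by omega)
    have := φ.iterate_mem_powSpan x (le_refl (Module.finrank F L))
    rwa [h0, Submodule.mem_bot] at this

/-! ### Jordan decomposition over a perfect field -/

/-- Perfectness provides `p`-th roots of the coefficients. -/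
theorem exists_toFun_eq [CharP F p] [PerfectField F] {x w : L} {i : ℕ}
    (hw : w ∈ φ.powSpan x (i + 1)) : ∃ u ∈ φ.powSpan x i, φ.toFun u = w := by
  have : ExpChar F p := ExpChar.prime Fact.out
  induction hw using Submodule.span_induction with
  | mem w hw =>
    obtain ⟨j, hj, rfl⟩ := hw
    obtain ⟨k, rfl⟩ := Nat.exists_eq_add_of_le' (show 1 ≤ j by omega)
    exact ⟨φ.toFun^[k] x, φ.iterate_mem_powSpan x (by omega),
      (Function.iterate_succ_apply' _ _ _).symm⟩
  | zero => exact ⟨0, zero_mem _, φ.toFun_zero⟩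
  | add a b _ _ h₁ h₂ =>
    obtain ⟨u, hu, rfl⟩ := h₁
    obtain ⟨v, hv, rfl⟩ := h₂
    exact ⟨u + v, add_mem hu hv, φ.toFun_add_of_lie
      (φ.lie_powSpan (φ.powSpan_le_zero x i hu) (φ.powSpan_le_zero x i hv))⟩
  | smul c a _ h =>
    obtain ⟨u, hu, rfl⟩ := h
    obtain ⟨b, rfl⟩ := (PerfectRing.bijective_frobenius (R := F) (p := p)).2 c
    exact ⟨b • u, Submodule.smul_mem _ _ hu, φ.map_smul b u⟩

theorem exists_iterate_eq [CharP F p] [PerfectField F] {x : L} {i : ℕ} (n : ℕ) :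
    ∀ {w : L}, w ∈ φ.powSpan x (i + n) → ∃ u ∈ φ.powSpan x i, φ.toFun^[n] u = w := by
  induction n with
  | zero => exact fun {w} hw => ⟨w, hw, rfl⟩
  | succ n ih =>
    intro w hw
    obtain ⟨v, hv, rfl⟩ := φ.exists_toFun_eq (i := i + n) hw
    obtain ⟨u, hu, rfl⟩ := ih hv
    exact ⟨u, hu, Function.iterate_succ_apply' _ _ _⟩

/-- The Jordan decomposition: over a perfect field, every element is the sum of a semisimple and
a nil element in the restricted subalgebra that it generates. -/
theorem exists_semisimple_add_nil [CharP F p] [PerfectField F] [FiniteDimensional F L] (x : L) :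
    ∃ s ∈ φ.powSpan x 0, ∃ t ∈ φ.powSpan x 0, x = s + t ∧ s ∈ φ.powSpan s 1 ∧ φ.IsNil t := by
  obtain ⟨n, hn⟩ := IsArtinian.monotone_stabilizes
    (⟨fun i => OrderDual.toDual (φ.powSpan x i), fun _ _ h => φ.powSpan_antitone x h⟩ :
      ℕ →o (Submodule F L)ᵒᵈ)
  replace hn : ∀ m, n ≤ m → φ.powSpan x n = φ.powSpan x m := hn
  -- Exponent `n + n` leaves the `n`-fold preimage `s` in the stable term `φ.powSpan x n`. Then `s`
  -- and `x` have the same `n`-th iterate, which kills `x - s`.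
  have hx : φ.toFun^[n] x ∈ φ.powSpan x (n + n) := by
    rw [← hn _ (by omega)]
    exact φ.iterate_mem_powSpan x le_rfl
  obtain ⟨s, hs, hsx⟩ := φ.exists_iterate_eq n hx
  have hs0 := φ.powSpan_le_zero x n hs
  have hx0 : x ∈ φ.powSpan x 0 := φ.self_mem_powSubalgebra x
  have ht0 : x - s ∈ φ.powSpan x 0 := sub_mem hx0 hs0
  refine ⟨s, hs0, x - s, ht0, (add_sub_cancel s x).symm, ?_, n, ?_⟩
  · rw [hn (n + 1) (by omega)] at hs
    refine φ.powSpan_le (fun j hj => ?_) hs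
    obtain ⟨k, rfl⟩ := Nat.exists_eq_add_of_le' (show n ≤ j by omega)
    rw [Function.iterate_add_apply, ← hsx, ← Function.iterate_add_apply]
    exact φ.iterate_mem_powSpan s (by omega)
  · have := φ.iterate_add_of_lie (φ.lie_powSpan hs0 ht0) n
    rwa [add_sub_cancel, hsx, left_eq_add] at this

/-! ### Semisimple elements of a nilpotent algebra -/

/-- `s` is a combination of arbitrarily high iterates, and these act as the powers `(ad s) ^ p ^ j`,
which vanish for large `j`. -/
theorem lie_eq_zero_of_mem_powSpan [LieRing.IsNilpotent L] {s : L} (hs : s ∈ φ.powSpan s 1)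
    (y : L) : ⁅s, y⁆ = 0 := by
  obtain ⟨k, hk⟩ := LieModule.exists_forall_pow_toEnd_eq_zero F L L
  have h := φ.powSpan_le_succ (i := 0) hs k (Nat.zero_le k) (φ.self_mem_powSubalgebra s)
  have key : φ.powSpan s k ≤ LinearMap.ker ((LieModule.toEnd F L L : L →ₗ[F] Module.End F L).flip y) := by
    refine φ.powSpan_le fun j hj => ?_
    rw [LinearMap.mem_ker]
    change ⁅φ.toFun^[j] s, y⁆ = 0
    have hz : (LieAlgebra.ad F L s) ^ k = 0 := hk s
    rw [φ.ad_iterate, pow_eq_zero_of_le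
      (hj.trans (Nat.lt_pow_self (Fact.out : p.Prime).one_lt).le) hz, LinearMap.zero_apply]
  exact LinearMap.mem_ker.1 (key h)

/-- The `p`-mapping is injective on a commutative subspace that is spanned by its image. -/
theorem eq_zero_of_toFun_eq_zero [FiniteDimensional F L] (D : Submodule F L)
    (hD : ∀ x ∈ D, ∀ y ∈ D, ⁅x, y⁆ = 0) (hmap : ∀ x ∈ D, φ.toFun x ∈ D)
    (hspan : D ≤ Submodule.span F (φ.toFun '' D)) {x : L} (hx : x ∈ D) (h : φ.toFun x = 0) :
    x = 0 := by
  have hsum : ∀ (ι : Type) (s : Finset ι) (c : ι → F) (e : ι → D),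
      φ.toFun (∑ i ∈ s, c i • (e i : L)) = ∑ i ∈ s, c i ^ p • φ.toFun (e i) := by
    classical
    intro ι s c e
    induction s using Finset.induction_on with
    | empty => simpa using φ.toFun_zero
    | insert a s ha ih =>
      rw [Finset.sum_insert ha, Finset.sum_insert ha, φ.toFun_add_of_lie, ih, φ.map_smul]
      exact hD _ (D.smul_mem _ (e a).2) _ (sum_mem fun i _ => D.smul_mem _ (e i).2)
  let b := Module.finBasis F D
  have hrepr : ∀ y : D, (y : L) = ∑ i, b.repr y i • (b i : L) := fun y => by
    simpa only [AddSubmonoidClass.coe_finsetSum, Submodule.coe_smul] using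
      congrArg Subtype.val (b.sum_repr y).symm
  let v : Fin (Module.finrank F D) → D := fun i => ⟨φ.toFun (b i), hmap _ (b i).2⟩
  -- The images of a basis span `D`; by their number they are independent, which forces every `c i ^
  -- p` to vanish.
  have hv : ⊤ ≤ Submodule.span F (Set.range v) := by
    have hle : D ≤ (Submodule.span F (Set.range v)).map D.subtype := by
      refine hspan.trans (Submodule.span_le.2 ?_)
      rintro _ ⟨y, hy, rfl⟩
      rw [show y = _ from hrepr ⟨y, hy⟩, hsum]
      exact sum_mem fun i _ => Submodule.smul_mem _ _
        ⟨v i, Submodule.subset_span ⟨i, rfl⟩, rfl⟩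
    intro y _
    obtain ⟨z, hz, hzy⟩ := hle y.2
    rwa [← Subtype.ext hzy]
  have hli := linearIndependent_of_top_le_span_of_card_eq_finrank hv (Fintype.card_fin _)
  have h0 : ∑ i, b.repr ⟨x, hx⟩ i ^ p • v i = 0 := by
    apply Subtype.ext
    rw [AddSubmonoidClass.coe_finsetSum]
    change ∑ i, b.repr ⟨x, hx⟩ i ^ p • φ.toFun (b i) = 0
    rw [← hsum, ← hrepr, h]
  have hc := Fintype.linearIndependent_iff.1 hli _ h0
  have := hrepr ⟨x, hx⟩
  rw [Finset.sum_eq_zero] at this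
  · exact this
  · intro i _
    rw [pow_eq_zero_iff (Fact.out : p.Prime).ne_zero |>.1 (hc i), zero_smul]

/-- The span of the semisimple elements. -/
def semisimpleSpan : Submodule F L := Submodule.span F {s | s ∈ φ.powSpan s 1}

theorem iterate_mem_powSpan_self {s : L} (hs : s ∈ φ.powSpan s 1) (n : ℕ) :
    φ.toFun^[n] s ∈ φ.powSpan (φ.toFun^[n] s) 1 := by
  have h := φ.iterate_mem_powSpan_add hs n
  refine φ.powSpan_le (fun j hj => ?_) h
  obtain ⟨k, rfl⟩ := Nat.exists_eq_add_of_le' (show n ≤ j by omega)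
  rw [Function.iterate_add_apply]
  exact φ.iterate_mem_powSpan _ (by omega)

theorem semisimpleSpan_le :
    φ.semisimpleSpan ≤ Submodule.span F (φ.toFun '' φ.semisimpleSpan) := by
  refine Submodule.span_le.2 fun s hs => φ.powSpan_le (fun j hj => ?_) hs
  obtain ⟨k, rfl⟩ := Nat.exists_eq_add_of_le' hj
  exact Submodule.subset_span ⟨φ.toFun^[k] s,
    Submodule.subset_span (φ.iterate_mem_powSpan_self hs k),
    (Function.iterate_succ_apply' _ _ _).symm⟩

section Nilpotent

variable [LieRing.IsNilpotent L]

theorem lie_semisimpleSpan {s : L} (hs : s ∈ φ.semisimpleSpan) (y : L) : ⁅s, y⁆ = 0 := by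
  induction hs using Submodule.span_induction with
  | mem s hs => exact φ.lie_eq_zero_of_mem_powSpan hs y
  | zero => exact zero_lie y
  | add a b _ _ h₁ h₂ => rw [add_lie, h₁, h₂, add_zero]
  | smul c a _ h => rw [smul_lie, h, smul_zero]

theorem toFun_mem_semisimpleSpan {s : L} (hs : s ∈ φ.semisimpleSpan) :
    φ.toFun s ∈ φ.semisimpleSpan := by
  induction hs using Submodule.span_induction with
  | mem s hs => exact Submodule.subset_span (φ.iterate_mem_powSpan_self hs 1)
  | zero => rw [φ.toFun_zero]; exact zero_mem _
  | add a b ha hb h₁ h₂ =>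
    rw [φ.toFun_add_of_lie (φ.lie_semisimpleSpan ha b)]
    exact add_mem h₁ h₂
  | smul c a _ h => rw [φ.map_smul]; exact Submodule.smul_mem _ _ h

variable [FiniteDimensional F L]

variable {φ} in
theorem IsNil.eq_zero {s : L} (hs : s ∈ φ.semisimpleSpan) (h : φ.IsNil s) : s = 0 := by
  obtain ⟨n, hn⟩ := h
  induction n generalizing s with
  | zero => exact hn
  | succ n ih =>
    exact φ.eq_zero_of_toFun_eq_zero _ (fun x hx y _ => φ.lie_semisimpleSpan hx y)
      (fun x hx => φ.toFun_mem_semisimpleSpan hx) φ.semisimpleSpan_le hs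
      (ih (φ.toFun_mem_semisimpleSpan hs) hn)

variable [CharP F p] [PerfectField F]

/-- The nil part of `x` is a difference of elements of the span, hence zero. -/
theorem mem_powSpan_of_mem_semisimpleSpan {x : L} (hx : x ∈ φ.semisimpleSpan) :
    x ∈ φ.powSpan x 1 := by
  obtain ⟨s, -, t, -, rfl, hs, ht⟩ := φ.exists_semisimple_add_nil x
  have hs' : s ∈ φ.semisimpleSpan := Submodule.subset_span hs
  have ht' : t ∈ φ.semisimpleSpan := by
    simpa using sub_mem hx hs'
  rw [ht.eq_zero ht', add_zero]
  exact hs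

/-! ### Nil elements under the quasi-ideal hypothesis -/

variable {φ}

/-- If all restricted subalgebras are quasi-ideals, the restricted subalgebras generated by two nil
elements span a restricted subalgebra, and it consists of nil elements. -/
theorem AllRestrictedQuasiIdeals.isNil_of_mem_sup (hφ : φ.AllRestrictedQuasiIdeals) {x y z : L}
    (hx : φ.IsNil x) (hy : φ.IsNil y)
    (hz : z ∈ φ.powSpan x 0 ⊔ φ.powSpan y 0) : φ.IsNil z := by
  have hlie : ∀ a ∈ φ.powSpan x 0, ∀ b ∈ φ.powSpan y 0,
      ⁅a, b⁆ ∈ φ.powSpan x 0 ⊔ φ.powSpan y 0 :=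
    (hφ _ (φ.isRestricted_powSubalgebra x)).2 _ (φ.isRestricted_powSubalgebra y)
  let M : LieSubalgebra F L :=
    { (φ.powSpan x 0 ⊔ φ.powSpan y 0 : Submodule F L) with
      lie_mem' := by
        intro u v hu hv
        obtain ⟨a, ha, b, hb, rfl⟩ := Submodule.mem_sup.1 hu
        obtain ⟨c, hc, d, hd, rfl⟩ := Submodule.mem_sup.1 hv
        change ⁅a + b, c + d⁆ ∈ φ.powSpan x 0 ⊔ φ.powSpan y 0
        rw [add_lie, lie_add, lie_add, φ.lie_powSpan ha hc, φ.lie_powSpan hb hd, zero_add,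
          add_zero, ← lie_skew b c]
        exact add_mem (hlie a ha d hd) (neg_mem (hlie c hc b hb)) }
  have hxM : ∀ a ∈ φ.powSpan x 0, a ∈ M := fun a ha => Submodule.mem_sup_left ha
  have hyM : ∀ a ∈ φ.powSpan y 0, a ∈ M := fun a ha => Submodule.mem_sup_right ha
  have hM : φ.IsRestricted M := by
    intro u hu
    obtain ⟨a, ha, b, hb, rfl⟩ := Submodule.mem_sup.1 hu
    exact φ.toFun_add_mem M (hxM a ha) (hyM b hb)
      (hxM _ (φ.isRestricted_powSubalgebra x a ha)) (hyM _ (φ.isRestricted_powSubalgebra y b hb))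
  obtain ⟨s, hs, t, -, rfl, hss, ht⟩ := φ.exists_semisimple_add_nil z
  have hsM : s ∈ φ.powSpan x 0 ⊔ φ.powSpan y 0 := φ.powSpan_le_of_isRestricted hM hz hs
  obtain ⟨a, ha, b, hb, hab⟩ := Submodule.mem_sup.1 hsM
  -- Centrality of `s = a + b` makes its two nil summands commute.
  have hc : ⁅a, b⁆ = 0 := by
    have h := φ.lie_eq_zero_of_mem_powSpan hss b
    rwa [← hab, add_lie, lie_self, add_zero] at h
  have hnil : φ.IsNil s := hab ▸ (hx.of_mem_powSpan ha).add (hy.of_mem_powSpan hb) hc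
  rw [hnil.eq_zero (Submodule.subset_span hss), zero_add]
  exact ht

theorem AllRestrictedQuasiIdeals.isNil_add (hφ : φ.AllRestrictedQuasiIdeals) {x y : L}
    (hx : φ.IsNil x) (hy : φ.IsNil y) : φ.IsNil (x + y) :=
  hφ.isNil_of_mem_sup hx hy (Submodule.add_mem_sup (φ.self_mem_powSubalgebra x)
    (φ.self_mem_powSubalgebra y))

/-- The semisimple part of `x` is central, so only its nil part contributes. -/
theorem AllRestrictedQuasiIdeals.isNil_lie (hφ : φ.AllRestrictedQuasiIdeals) (x : L) {y : L}
    (hy : φ.IsNil y) : φ.IsNil ⁅x, y⁆ := by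
  obtain ⟨s, -, t, -, rfl, hs, ht⟩ := φ.exists_semisimple_add_nil x
  rw [add_lie, φ.lie_eq_zero_of_mem_powSpan hs, zero_add]
  exact hφ.isNil_of_mem_sup ht hy
    ((hφ _ (φ.isRestricted_powSubalgebra t)).2 _ (φ.isRestricted_powSubalgebra y) _
      (φ.self_mem_powSubalgebra t) _ (φ.self_mem_powSubalgebra y))

variable (φ) in
/-- The ideal spanned by the semisimple elements. -/
def semisimpleIdeal : LieIdeal F L where
  __ := φ.semisimpleSpan
  lie_mem {x m} hm := by
    rw [← lie_skew, φ.lie_semisimpleSpan hm, neg_zero]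
    exact zero_mem φ.semisimpleSpan

/-- The ideal of the nil elements. -/
def AllRestrictedQuasiIdeals.nilIdeal (hφ : φ.AllRestrictedQuasiIdeals) : LieIdeal F L where
  carrier := {x | φ.IsNil x}
  add_mem' := hφ.isNil_add
  zero_mem' := ⟨0, rfl⟩
  smul_mem' c _ hx := hx.smul c
  lie_mem {x _} hm := hφ.isNil_lie x hm

end Nilpotent

end Prime

/-! ### Passing to subalgebras and splitting off a torus -/

theorem AllRestrictedQuasiIdeals.restrict {φ : PMapping p F L} (hφ : φ.AllRestrictedQuasiIdeals)
    (P : LieSubalgebra F L) (hP : φ.IsRestricted P) :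
    (φ.restrict P hP).AllRestrictedQuasiIdeals := by
  have hmap : ∀ A : LieSubalgebra F P, (φ.restrict P hP).IsRestricted A →
      φ.IsRestricted (A.map P.incl) := by
    rintro A hA _ ⟨a, ha, rfl⟩
    exact ⟨_, hA a ha, rfl⟩
  intro A hA
  refine ⟨hA, fun H hH a ha h hh => ?_⟩
  have := (hφ _ (hmap A hA)).2 _ (hmap H hH) a ⟨a, ha, rfl⟩ h ⟨h, hh, rfl⟩
  obtain ⟨_, ⟨u, hu, rfl⟩, _, ⟨v, hv, rfl⟩, huv⟩ := Submodule.mem_sup.1 this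
  exact Submodule.mem_sup.2 ⟨u, hu, v, hv, Subtype.ext huv⟩

theorem isRestricted_comap_incl {φ : PMapping p F L} {P H : LieSubalgebra F L}
    (hP : φ.IsRestricted P) (hH : φ.IsRestricted H) :
    (φ.restrict P hP).IsRestricted (H.comap P.incl) := fun x hx => hH x hx

/-- Semisimplicity recovers `s` from its `p`-th power inside any restricted subalgebra, one iterate
at a time. -/
theorem IsTorus.mem_of_iterate_mem {φ : PMapping p F L} {S : LieSubalgebra F L}
    {hS : φ.IsRestricted S} (hT : (φ.restrict S hS).IsTorus) {H : LieSubalgebra F L}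
    (hH : φ.IsRestricted H) (n : ℕ) {s : L} (hs : s ∈ S) (h : φ.toFun^[n] s ∈ H) : s ∈ H := by
  induction n generalizing s with
  | zero => exact h
  | succ n ih =>
    have h₁ : φ.toFun s ∈ H := ih (hS s hs) h
    have h₂ : (⟨s, hs⟩ : S) ∈ H.comap S.incl :=
      (mem_closure _).1 (hT.2 ⟨s, hs⟩) _
        ⟨isRestricted_comap_incl hS hH, Set.singleton_subset_iff.2 h₁⟩
    exact h₂

/-- A central torus and a `p`-nilpotent restricted ideal split every restricted subalgebra. -/
theorem mem_of_add_mem [Fact p.Prime] {φ : PMapping p F L} {S P H : LieSubalgebra F L}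
    {hS : φ.IsRestricted S} {hP : φ.IsRestricted P} (hT : (φ.restrict S hS).IsTorus)
    (hN : (φ.restrict P hP).IsPNilpotent) (hH : φ.IsRestricted H) {s t : L} (hs : s ∈ S)
    (ht : t ∈ P) (hst : ⁅s, t⁆ = 0) (h : s + t ∈ H) : t ∈ H := by
  obtain ⟨n, -, hn⟩ := hN
  have h0 : φ.toFun^[n] t = 0 := by
    rw [← φ.coe_restrict_iterate P hP ⟨t, ht⟩ n, hn]
    rfl
  -- The `n`-th iterate kills `t`, so `H` contains that of `s`, hence `s` itself.
  have h₁ := hH.iterate_mem h n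
  rw [φ.iterate_add_of_lie hst, h0, add_zero] at h₁
  simpa using sub_mem h (hT.mem_of_iterate_mem hH n hs h₁)

end PMapping

/-! ### The equivalence -/

open PMapping in
theorem mainTheorem10 {F L : Type*} [Field F] [PerfectField F] (p : ℕ) [Fact p.Prime] [CharP F p]
    (hp : p ≠ 2) [LieRing L] [LieAlgebra F L] [FiniteDimensional F L] [LieRing.IsNilpotent L]
    (φ : PMapping p F L) :
    φ.AllRestrictedQuasiIdeals ↔
      ∃ (S P : LieIdeal F L) (hS : φ.IsRestricted S.toLieSubalgebra)
        (hP : φ.IsRestricted P.toLieSubalgebra),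
        IsCompl S P ∧
        (φ.restrict S.toLieSubalgebra hS).IsTorus ∧
        (φ.restrict P.toLieSubalgebra hP).IsPNilpotent ∧
        (φ.restrict P.toLieSubalgebra hP).AllRestrictedQuasiIdeals := by
  constructor
  · intro hφ
    have hS : φ.IsRestricted φ.semisimpleIdeal.toLieSubalgebra := fun x hx =>
      φ.toFun_mem_semisimpleSpan hx
    have hP : φ.IsRestricted hφ.nilIdeal.toLieSubalgebra := by
      rintro x ⟨n, hn⟩
      refine ⟨n, ?_⟩
      rw [← Function.iterate_succ_apply]
      exact IsNil.iterate_eq_zero hn (Nat.le_succ n)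
    refine ⟨φ.semisimpleIdeal, hφ.nilIdeal, hS, hP, ⟨?_, ?_⟩, ⟨⟨?_⟩, ?_⟩, ?_, hφ.restrict _ _⟩
    · rw [disjoint_iff_inf_le]
      rintro x ⟨hx, hx'⟩
      exact (LieSubmodule.mem_bot x).2 (IsNil.eq_zero hx hx')
    · rw [codisjoint_iff_le_sup]
      intro x _
      obtain ⟨s, -, t, -, rfl, hs, ht⟩ := φ.exists_semisimple_add_nil x
      exact LieSubmodule.mem_sup _ _ _ |>.2 ⟨s, Submodule.subset_span hs, t, ht, rfl⟩
    · intro x y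
      exact Subtype.ext (φ.lie_semisimpleSpan x.2 y)
    · intro x
      refine (mem_closure _).2 fun H hH => ?_
      have hle : φ.powSpan x 1 ≤ (H.map (LieSubalgebra.incl _)).toSubmodule := by
        refine φ.powSpan_le fun j hj => ?_
        obtain ⟨k, rfl⟩ := Nat.exists_eq_add_of_le' hj
        refine ⟨_, hH.1.iterate_mem (Set.singleton_subset_iff.1 hH.2) k, ?_⟩
        exact φ.coe_restrict_iterate _ hS _ k
      obtain ⟨y, hy, hyx⟩ := hle (φ.mem_powSpan_of_mem_semisimpleSpan x.2)
      rwa [← Subtype.ext hyx]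
    -- The extra `1` keeps the exponent positive when `L = 0`.
    · refine ⟨Module.finrank F L + 1, Nat.succ_pos _, fun x => Subtype.ext ?_⟩
      rw [coe_restrict_iterate]
      exact IsNil.iterate_eq_zero (IsNil.iterate_finrank x.2) (Nat.le_succ _)
  · rintro ⟨S, P, hS, hP, hc, hT, hN, hQ⟩
    have hSP : ∀ s ∈ S, ∀ t ∈ P, ⁅s, t⁆ = 0 := fun s hs t ht => by
      have h : ⁅s, t⁆ ∈ S ⊓ P := ⟨lie_mem_left F L S s t hs, P.lie_mem ht⟩
      rwa [hc.inf_eq_bot, LieSubmodule.mem_bot] at h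
    have hSS : ∀ s ∈ S, ∀ t ∈ S, ⁅s, t⁆ = 0 := fun s hs t ht =>
      congrArg Subtype.val (hT.1.trivial ⟨s, hs⟩ ⟨t, ht⟩)
    have hdec : ∀ x : L, ∃ s ∈ S, ∃ t ∈ P, s + t = x := fun x =>
      (LieSubmodule.mem_sup _ _ _).1 (hc.sup_eq_top ▸ LieSubmodule.mem_top x)
    intro A hA
    refine ⟨hA, fun H hH a ha h hh => ?_⟩
    obtain ⟨s, hs, t, ht, rfl⟩ := hdec a
    obtain ⟨u, hu, v, hv, rfl⟩ := hdec h
    have htA : t ∈ A := mem_of_add_mem hT hN hA hs ht (hSP s hs t ht) ha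
    have hvH : v ∈ H := mem_of_add_mem hT hN hH hu hv (hSP u hu v hv) hh
    -- `S` is abelian and commutes with `P`, so only the `P`-components matter.
    have heq : ⁅s + t, u + v⁆ = ⁅t, v⁆ := by
      rw [add_lie, lie_add, lie_add, hSS s hs u hu, hSP s hs v hv, ← lie_skew t u, hSP u hu t ht]
      simp
    rw [heq]
    have := (hQ _ (isRestricted_comap_incl hP hA)).2 _ (isRestricted_comap_incl hP hH)
      ⟨t, ht⟩ htA ⟨v, hv⟩ hvH
    obtain ⟨b, hb, c, hc', hbc⟩ := Submodule.mem_sup.1 this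
    exact Submodule.mem_sup.2 ⟨b, hb, c, hc', congrArg Subtype.val hbc⟩
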